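/- Let $I$ be a finite set with at least two elements, let $I^*=\bigcup_{n\ge1}I^n$ be the set of nonempty finite words over $I$ (with $|\mathtt i|=n$ for $\mathtt i\in I^n$), let $I^\infty=I^{\mathbb N}$ carry the product of the discrete topologies and its Borel $\sigma$-algebra, and let $\sigma(i_1,i_2,\dots)=(i_2,i_3,\dots)$ be the left shift on $I^\infty$. For $\mathtt i\in I^*$ let $[\mathtt i]\subset I^\infty$ be the cylinder set of all infinite sequences that begin with $\mathtt i$. For each real $t\ge 0$ and each $\mathtt i\in I^*$ let $\psi^t_{\mathtt i}:I^\infty\to(0,\infty)$ be a function. Assume that this collection is a cylinder function, that is: (1) for each $t\ge0$ there is $K_t\ge 1$ with $\psi^t_{\mathtt i}(\mathtt h)\le K_t\,\psi^t_{\mathtt i}(\mathtt j)$ for all $\mathtt i\in I^*$ and $\mathtt h,\mathtt j\in I^\infty$; (2) for all $t\ge0$, all $\mathtt i=(i_1,\dots,i_n)\in I^*$, all $1\le j<n$ and all $\mathtt h\in I^\infty$, writing $\mathtt i|_j=(i_1,\dots,i_j)$ and $\mathtt k=(i_{j+1},\dots,i_n)$, we have $\psi^t_{\mathtt i}(\mathtt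 h)\le\psi^t_{\mathtt i|_j}(\mathtt k,\mathtt h)\,\psi^t_{\mathtt k}(\mathtt h)$, where $\mathtt k,\mathtt h$ denotes the juxtaposition of $\mathtt k$ and $\mathtt h$; (3) there are constants $\underline s,\overline s\in(0,1)$ with $\psi^t_{\mathtt i}(\mathtt h)\,\underline s^{\delta|\mathtt i|}\le\psi^{t+\delta}_{\mathtt i}(\mathtt h)\le\psi^t_{\mathtt i}(\mathtt h)\,\overline s^{\delta|\mathtt i|}$ for all $t,\delta\ge0$, $\mathtt i\in I^*$ and $\mathtt h\in I^\infty$. Then for every $t\ge0$ the following holds. The topological pressure $$P(t)=\lim_{n\to\infty}\frac1n\log\sum_{\mathtt i\in I^n}\psi^t_{\mathtt i}(\mathtt h)$$ exists in $[-\infty,\infty)$ and does not depend on $\mathtt h\in I^\infty$; it is finite if there is $c>0$ with $\psi^t_{\mathtt i}(\mathtt h)\ge c^{|\mathtt i|}$ for all $\mathtt i\in I^*$ and $\mathtt h\in I^\infty$. Moreover, there is a Borel probability measure $\mu$ on $I^\infty$ that is invariant and ergodic under $\sigma$, for which the entropy $$h_\mu=-\lim_{n\to\infty}\frac1n\sum_{\mathtt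 i\in I^n}\mu([\mathtt i])\log\mu([\mathtt i])$$ (with $0\log0=0$) exists in $\mathbb R$, the energy $$E_\mu(t)=\lim_{n\to\infty}\frac1n\sum_{\mathtt i\in I^n}\mu([\mathtt i])\log\psi^t_{\mathtt i}(\mathtt h)$$ exists in $[-\infty,\infty)$ and does not depend on $\mathtt h\in I^\infty$, and $$P(t)=h_\mu+E_\mu(t).$$ (In particular, $E_\mu(t)$ is finite whenever $P(t)$ is.) -/

import Mathlib

open MeasureTheory Filter Topology
open scoped NNReal

namespace SymbolSpace

/-- The left shift on the symbol space `ℕ → I` of one-sided infinite sequences. -/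
def shift {I : Type*} (x : ℕ → I) : ℕ → I := fun n => x (n + 1)

/-- Juxtaposition of a finite word `w` and an infinite sequence `h`. -/
def prepend {I : Type*} (w : List I) (h : ℕ → I) : ℕ → I :=
  fun n => if hn : n < w.length then w[n] else h (n - w.length)

/-- The cylinder set of all infinite sequences with initial word `w`. -/
def cylinder {I : Type*} (w : List I) : Set (ℕ → I) :=
  {x | ∀ (n : ℕ) (hn : n < w.length), x n = w[n]}

theorem cylinder_eq_range {I : Type*} (w : List I) : cylinder w = Set.range (prepend w) := by
  ext x
  constructor
  · intro hx
    refine ⟨fun n => x (n + w.length), ?_⟩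
    funext n
    by_cases hn : n < w.length
    · simp [prepend, hn, hx n hn]
    · simp only [prepend, hn, dite_false]
      congr 1
      omega
  · rintro ⟨h, rfl⟩ n hn
    simp [prepend, hn]

/-- Cylinder functions. The finite words are the nonempty lists over `I`; the value of `ψ t` at
the empty list is irrelevant. The fields are positivity, bounded variation, the subchain rule, and
the regular dependence on the parameter. -/
structure IsCylinderFunction {I : Type*} (ψ : ℝ≥0 → List I → (ℕ → I) → ℝ) : Prop where
  pos : ∀ (t : ℝ≥0) (w : List I), w ≠ [] → ∀ h : ℕ → I, 0 < ψ t w h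
  bounded_variation : ∀ t : ℝ≥0, ∃ K : ℝ, 1 ≤ K ∧
    ∀ w : List I, w ≠ [] → ∀ h j : ℕ → I, ψ t w h ≤ K * ψ t w j
  subchain : ∀ (t : ℝ≥0) (w : List I) (j : ℕ), 1 ≤ j → j < w.length → ∀ h : ℕ → I,
    ψ t w h ≤ ψ t (w.take j) (prepend (w.drop j) h) * ψ t (w.drop j) h
  parameter : ∃ a b : ℝ, 0 < a ∧ a < 1 ∧ 0 < b ∧ b < 1 ∧
    ∀ (t δ : ℝ≥0) (w : List I), w ≠ [] → ∀ h : ℕ → I,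
      ψ t w h * a ^ ((δ : ℝ) * w.length) ≤ ψ (t + δ) w h ∧
      ψ (t + δ) w h ≤ ψ t w h * b ^ ((δ : ℝ) * w.length)

/-- `p` is the topological pressure `P(t)`: the limit exists in the extended reals and equals `p`,
for every choice of the base point `h`. -/
def HasPressure {I : Type*} [Fintype I] (ψ : ℝ≥0 → List I → (ℕ → I) → ℝ) (t : ℝ≥0)
    (p : EReal) : Prop :=
  ∀ h : ℕ → I, Tendsto
    (fun n : ℕ => (((1 / (n : ℝ)) * Real.log (∑ w : Fin n → I, ψ t (List.ofFn w) h) : ℝ) : EReal))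
    atTop (𝓝 p)

/-- `e` is the energy `E_μ(t)`: the limit exists in the extended reals and equals `e`, for every
choice of the base point `h`. -/
def HasEnergy {I : Type*} [Fintype I] [MeasurableSpace I] (ψ : ℝ≥0 → List I → (ℕ → I) → ℝ)
    (t : ℝ≥0) (μ : Measure (ℕ → I)) (e : EReal) : Prop :=
  ∀ h : ℕ → I, Tendsto
    (fun n : ℕ => (((1 / (n : ℝ)) * ∑ w : Fin n → I,
      μ.real (cylinder (List.ofFn w)) * Real.log (ψ t (List.ofFn w) h) : ℝ) : EReal))
    atTop (𝓝 e)

/-- `s` is the entropy `h_μ` : the defining limit exists in the reals and equals `s`. Note that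
`Real.negMulLog x = - x * log x`, with value `0` at `0`. -/
def HasEntropy {I : Type*} [Fintype I] [MeasurableSpace I] (μ : Measure (ℕ → I)) (s : ℝ) : Prop :=
  Tendsto (fun n : ℕ => (1 / (n : ℝ)) * ∑ w : Fin n → I,
    Real.negMulLog (μ.real (cylinder (List.ofFn w)))) atTop (𝓝 s)

end SymbolSpace

namespace SymbolSpace

/-! ### Entropy inequalities for finite probability vectors -/

section FiniteDistributions

open Real

/-! Fix a base point and set `f w = log K + log ψ w`, with `f [] = 0`. Bounded variation and the
subchain rule make `f` subadditive under concatenation, and a change of base point alters `log ψ` by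
a bounded amount, which dividing by `n` removes. So the pressure is the Fekete limit of
`logPartition f n / n`, either a real `P` or `⊥`.

The central quantity is `blockFree f n μ`, the entropy plus mean potential of the first `n` letters.
It is at most `logPartition f n`, with equality for the Gibbs distribution on words of length `n`.
If `P = ⊥`, any measure with nonnegative block entropy has energy `⊥`, so a point mass at a fixed
sequence suffices. If `P` is real, it is enough to find an ergodic `μ` with `n * P ≤ blockFree f n
μ` for all `n ≠ 0`: then `blockFree f n μ / n` tends to `P`, the entropy converges by subadditivity,
and the energy converges to the difference.

An invariant such `μ` is a limit of shift averages of Gibbs measures: `mul_blockFree_le` cuts a long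
word into blocks at every offset, and concavity moves the estimate to the averaged measure. The
measures obtained this way form a compact set, which is a face of the invariant measures because
block entropy is affine up to an error independent of `n`. An extreme point of it is therefore
ergodic. -/

theorem negMulLog_le_of_absolutelyContinuous {x y : ℝ} (hx : 0 ≤ x) (hy : 0 ≤ y)
    (h : y = 0 → x = 0) : negMulLog x ≤ -x * log y + y - x := by
  rcases hx.eq_or_lt with rfl | hx
  · simpa using hy
  · have hy : 0 < y := lt_of_le_of_ne hy fun h0 => hx.ne' (h h0.symm)
    have h1 := log_le_sub_one_of_pos (div_pos hy hx)
    rw [log_div hy.ne' hx.ne'] at h1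
    have h2 := mul_le_mul_of_nonneg_left h1 hx.le
    have h3 : x * (y / x - 1) = y - x := by field_simp
    rw [negMulLog]
    linarith

/-- The finite Gibbs variational inequality. -/
theorem sum_negMulLog_add_le_log_sum_exp {α : Type*} [Fintype α] (p f : α → ℝ)
    (hp : ∀ a, 0 ≤ p a) (hp1 : ∑ a, p a = 1) :
    ∑ a, (negMulLog (p a) + p a * f a) ≤ log (∑ a, exp (f a)) := by
  have : Nonempty α := by
    by_contra hα
    rw [not_nonempty_iff] at hα
    simp at hp1
  set Z := ∑ a, exp (f a) with hZ
  have hZ0 : 0 < Z := Finset.sum_pos (fun _ _ => exp_pos _) Finset.univ_nonempty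
  have key : ∀ a, negMulLog (p a) + p a * f a ≤ p a * log Z + exp (f a) / Z - p a := fun a => by
    have h := negMulLog_le_of_absolutelyContinuous (hp a) (div_pos (exp_pos (f a)) hZ0).le
      fun h => absurd h (div_pos (exp_pos (f a)) hZ0).ne'
    rw [log_div (exp_pos _).ne' hZ0.ne', log_exp] at h
    linarith
  refine (Finset.sum_le_sum fun a _ => key a).trans_eq ?_
  rw [Finset.sum_sub_distrib, Finset.sum_add_distrib, ← Finset.sum_mul, ← Finset.sum_div, hp1,
    ← hZ, div_self hZ0.ne']
  ring

/-- For the weights `p = exp f / Z`, the quantity `f - log p` is the constant `log Z`; this is the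
equality case of the variational inequality. -/
theorem sum_negMulLog_gibbs {α : Type*} [Fintype α] [Nonempty α] (f : α → ℝ) :
    ∑ a, (negMulLog (exp (f a) / ∑ b, exp (f b)) + exp (f a) / (∑ b, exp (f b)) * f a) =
      log (∑ a, exp (f a)) := by
  set Z := ∑ a, exp (f a) with hZ
  have hZ0 : 0 < Z := Finset.sum_pos (fun _ _ => exp_pos _) Finset.univ_nonempty
  have : ∀ a, negMulLog (exp (f a) / Z) + exp (f a) / Z * f a = exp (f a) / Z * log Z :=
    fun a => by
      rw [negMulLog, log_div (exp_pos _).ne' hZ0.ne', log_exp]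
      ring
  simp_rw [this]
  rw [← Finset.sum_mul, ← Finset.sum_div, ← hZ, div_self hZ0.ne', one_mul]

/-- Subadditivity of the entropy of a finite joint distribution. -/
theorem sum_negMulLog_le_marginals {α β : Type*} [Fintype α] [Fintype β] (r : α → β → ℝ)
    (p : α → ℝ) (q : β → ℝ) (hr : ∀ a b, 0 ≤ r a b) (hp : ∀ a, ∑ b, r a b = p a)
    (hq : ∀ b, ∑ a, r a b = q b) (h1 : ∑ a, p a = 1) :
    ∑ a, ∑ b, negMulLog (r a b) ≤ ∑ a, negMulLog (p a) + ∑ b, negMulLog (q b) := by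
  have hp0 : ∀ a, 0 ≤ p a := fun a => hp a ▸ Finset.sum_nonneg fun b _ => hr a b
  have hq0 : ∀ b, 0 ≤ q b := fun b => hq b ▸ Finset.sum_nonneg fun a _ => hr a b
  have hpr : ∀ a b, r a b ≤ p a := fun a b =>
    hp a ▸ Finset.single_le_sum (f := fun b => r a b) (fun b _ => hr a b) (Finset.mem_univ b)
  have hqr : ∀ a b, r a b ≤ q b := fun a b =>
    hq b ▸ Finset.single_le_sum (f := fun a => r a b) (fun a _ => hr a b) (Finset.mem_univ a)
  have hq1 : ∑ b, q b = 1 := by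
    simp_rw [← hq]
    rw [Finset.sum_comm]
    simp_rw [hp, h1]
  have key : ∀ a b, negMulLog (r a b) ≤
      -(r a b * log (p a)) + -(r a b * log (q b)) + (p a * q b - r a b) := fun a b => by
    -- Comparison with the product of the marginals: where the product vanishes, so does `r`, being
    -- bounded by each marginal.
    have h := negMulLog_le_of_absolutelyContinuous (hr a b) (mul_nonneg (hp0 a) (hq0 b)) fun h => by
      rcases mul_eq_zero.1 h with h | h
      · exact le_antisymm (h ▸ hpr a b) (hr a b)
      · exact le_antisymm (h ▸ hqr a b) (hr a b)
    rcases (hr a b).eq_or_lt with h0 | h0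
    · rw [← h0] at h ⊢
      simpa using mul_nonneg (hp0 a) (hq0 b)
    · rw [log_mul (h0.trans_le (hpr a b)).ne' (h0.trans_le (hqr a b)).ne'] at h
      linarith
  refine (Finset.sum_le_sum fun a _ => Finset.sum_le_sum fun b _ => key a b).trans_eq ?_
  simp_rw [Finset.sum_add_distrib, Finset.sum_sub_distrib, Finset.sum_neg_distrib,
    ← Finset.sum_mul, ← Finset.mul_sum, hq1, hp]
  rw [Finset.sum_comm (f := fun a b => r a b * log (q b))]
  simp_rw [← Finset.sum_mul, hq, h1, negMulLog, neg_mul, Finset.sum_neg_distrib]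
  simp

theorem negMulLog_add_le {x y : ℝ} (hx : 0 ≤ x) (hy : 0 ≤ y) :
    negMulLog (x + y) ≤ negMulLog x + negMulLog y := by
  rcases hx.eq_or_lt with rfl | hx
  · simp
  rcases hy.eq_or_lt with rfl | hy
  · simp
  have h1 := mul_le_mul_of_nonneg_left (log_le_log hx (by linarith : x ≤ x + y)) hx.le
  have h2 := mul_le_mul_of_nonneg_left (log_le_log hy (by linarith : y ≤ x + y)) hy.le
  simp only [negMulLog]
  linarith

/-- A converse to concavity. Summed over two probability vectors, its error is the entropy of `(a,
b)`, whatever the number of atoms. -/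
theorem negMulLog_convexCombination_le {a b x y : ℝ} (ha : 0 ≤ a) (hb : 0 ≤ b) (hx : 0 ≤ x)
    (hy : 0 ≤ y) : negMulLog (a * x + b * y) ≤
      a * negMulLog x + b * negMulLog y + (x * negMulLog a + y * negMulLog b) := by
  refine (negMulLog_add_le (mul_nonneg ha hx) (mul_nonneg hb hy)).trans_eq ?_
  rw [negMulLog_mul, negMulLog_mul]
  ring

end FiniteDistributions

/-! ### Cylinders as a clopen generating π-system -/

section Cylinders

variable {I : Type*}

theorem mem_cylinder_ofFn {n : ℕ} {w : Fin n → I} {x : ℕ → I} :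
    x ∈ cylinder (List.ofFn w) ↔ (fun i : Fin n => x i) = w := by
  simp only [cylinder, Set.mem_ofPred_eq, List.length_ofFn, List.getElem_ofFn]
  exact ⟨fun h => funext fun i => h i i.2, fun h n hn => by rw [← h]⟩

theorem cylinder_ofFn_eq_preimage {n : ℕ} (w : Fin n → I) :
    cylinder (List.ofFn w) = (fun (x : ℕ → I) (i : Fin n) => x i) ⁻¹' {w} :=
  Set.ext fun _ => mem_cylinder_ofFn

theorem shift_iterate_apply (x : ℕ → I) (j n : ℕ) : (shift^[j] x) n = x (j + n) := by
  induction j generalizing x with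
  | zero => simp
  | succ j ih =>
    rw [Function.iterate_succ_apply, ih, shift]
    congr 1
    omega

theorem cylinder_append {a b : ℕ} (u : Fin a → I) (v : Fin b → I) :
    cylinder (List.ofFn (Fin.append u v)) =
      cylinder (List.ofFn u) ∩ shift^[a] ⁻¹' cylinder (List.ofFn v) := by
  ext x
  simp only [Set.mem_inter_iff, Set.mem_preimage, mem_cylinder_ofFn, shift_iterate_apply]
  constructor
  · intro h
    refine ⟨funext fun i => ?_, funext fun i => ?_⟩
    · simpa using congrFun h (Fin.castAdd b i)
    · simpa using congrFun h (Fin.natAdd a i)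
  · rintro ⟨rfl, rfl⟩
    funext i
    refine Fin.addCases (fun i => ?_) (fun i => ?_) i <;> simp

theorem sum_append {M : Type*} [AddCommMonoid M] [Fintype I] {a b : ℕ}
    (F : (Fin (a + b) → I) → M) :
    ∑ w, F w = ∑ u : Fin a → I, ∑ v : Fin b → I, F (Fin.append u v) := by
  rw [← Fintype.sum_prod_type' (fun u v => F (Fin.append u v))]
  exact (Fintype.sum_equiv (Fin.appendEquiv a b) _ _ fun _ => rfl).symm

/-- Two cylinders that meet are nested. -/
theorem isPiSystem_cylinders :
    IsPiSystem {s : Set (ℕ → I) | ∃ (n : ℕ) (w : Fin n → I), s = cylinder (List.ofFn w)} := by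
  have key : ∀ (n m : ℕ) (w : Fin n → I) (v : Fin m → I), n ≤ m →
      (cylinder (List.ofFn w) ∩ cylinder (List.ofFn v)).Nonempty →
      cylinder (List.ofFn v) ⊆ cylinder (List.ofFn w) := by
    rintro n m w v hnm ⟨y, hy1, hy2⟩ x hx
    rw [mem_cylinder_ofFn] at *
    rw [← hy1]
    funext i
    exact congrFun (hx.trans hy2.symm) (Fin.castLE hnm i)
  rintro _ ⟨n, w, rfl⟩ _ ⟨m, v, rfl⟩ hne
  rcases le_total n m with h | h
  · exact ⟨m, v, Set.inter_eq_right.2 (key n m w v h hne)⟩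
  · exact ⟨n, w, Set.inter_eq_left.2 (key m n v w h (by rwa [Set.inter_comm]))⟩

theorem measurable_shift [MeasurableSpace I] : Measurable (shift : (ℕ → I) → ℕ → I) :=
  measurable_pi_lambda _ fun n => measurable_pi_apply (n + 1)

theorem measurable_shift_iterate [MeasurableSpace I] (j : ℕ) : Measurable (shift^[j] : (ℕ → I) → ℕ → I) :=
  measurable_shift.iterate j

variable [TopologicalSpace I] [DiscreteTopology I]

theorem isClopen_cylinder_ofFn {n : ℕ} (w : Fin n → I) : IsClopen (cylinder (List.ofFn w)) := by
  rw [cylinder_ofFn_eq_preimage]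
  exact (isClopen_discrete {w}).preimage (by fun_prop)

variable [Fintype I] [MeasurableSpace I] [BorelSpace I]

theorem measurableSet_cylinder_ofFn {n : ℕ} (w : Fin n → I) :
    MeasurableSet (cylinder (List.ofFn w)) :=
  (isClopen_cylinder_ofFn w).isOpen.measurableSet

theorem sum_measureReal_inter_cylinder (μ : Measure (ℕ → I)) [IsFiniteMeasure μ]
    {g : (ℕ → I) → ℕ → I} (hg : Measurable g) (s : Set (ℕ → I)) (n : ℕ) :
    ∑ w : Fin n → I, μ.real (s ∩ g ⁻¹' cylinder (List.ofFn w)) = μ.real s := by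
  have hm : ∀ w : Fin n → I, MeasurableSet (g ⁻¹' cylinder (List.ofFn w)) :=
    fun w => hg (measurableSet_cylinder_ofFn w)
  have := sum_measureReal_preimage_singleton (μ := μ.restrict s) (Finset.univ : Finset (Fin n → I))
    (f := fun x (i : Fin n) => g x i) (fun w _ => by
      have := hm w
      rw [cylinder_ofFn_eq_preimage] at this
      exact this)
  simp only [Finset.coe_univ, Set.preimage_univ, measureReal_restrict_apply_univ] at this
  rw [← this]
  refine Finset.sum_congr rfl fun w _ => ?_
  have h2 : (fun x (i : Fin n) => g x i) ⁻¹' {w} = g ⁻¹' cylinder (List.ofFn w) := by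
    rw [cylinder_ofFn_eq_preimage]; rfl
  rw [h2, measureReal_restrict_apply (hm w), Set.inter_comm]

theorem sum_measureReal_cylinder (μ : Measure (ℕ → I)) [IsProbabilityMeasure μ] (n : ℕ) :
    ∑ w : Fin n → I, μ.real (cylinder (List.ofFn w)) = 1 := by
  simpa using sum_measureReal_inter_cylinder μ measurable_id Set.univ n

theorem generateFrom_cylinders : (MeasurableSpace.pi : MeasurableSpace (ℕ → I)) =
    MeasurableSpace.generateFrom
      {s : Set (ℕ → I) | ∃ (n : ℕ) (w : Fin n → I), s = cylinder (List.ofFn w)} := by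
  apply le_antisymm
  · refine iSup_le fun i => ?_
    rintro _ ⟨s, -, rfl⟩
    have : (fun x : ℕ → I => x i) ⁻¹' s =
        ⋃ w ∈ {w : Fin (i + 1) → I | w (Fin.last i) ∈ s}, cylinder (List.ofFn w) := by
      ext x
      simp only [Set.mem_preimage, Set.mem_iUnion, mem_cylinder_ofFn, Set.mem_ofPred_eq,
        exists_prop]
      exact ⟨fun h => ⟨fun j => x j, h, rfl⟩, by rintro ⟨w, hw, rfl⟩; exact hw⟩
    rw [this]
    refine MeasurableSet.biUnion (Set.toFinite _).countable fun w _ => ?_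
    exact MeasurableSpace.measurableSet_generateFrom ⟨_, w, rfl⟩
  · refine MeasurableSpace.generateFrom_le ?_
    rintro _ ⟨n, w, rfl⟩
    exact measurableSet_cylinder_ofFn w

theorem measure_ext_cylinder {μ ν : Measure (ℕ → I)} [IsProbabilityMeasure μ]
    [IsProbabilityMeasure ν]
    (h : ∀ (n : ℕ) (w : Fin n → I),
      μ.real (cylinder (List.ofFn w)) = ν.real (cylinder (List.ofFn w))) : μ = ν := by
  refine ext_of_generate_finite _ generateFrom_cylinders isPiSystem_cylinders ?_ (by simp)
  rintro _ ⟨n, w, rfl⟩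
  exact (measureReal_eq_measureReal_iff).1 (h n w)

end Cylinders

/-! ### Block entropy plus potential: subadditivity and near-affinity -/

section BlockFunctional

theorem isProbabilityMeasure_map_shift_iterate {I : Type*} [MeasurableSpace I]
    (ν : Measure (ℕ → I)) [IsProbabilityMeasure ν] (j : ℕ) : IsProbabilityMeasure (ν.map shift^[j]) :=
  Measure.isProbabilityMeasure_map (measurable_shift_iterate j).aemeasurable

open Real

variable {I : Type*} [Fintype I]

/-- The logarithm of the partition function over words of length `n` with weights `exp f`. -/
noncomputable def logPartition (f : List I → ℝ) (n : ℕ) : ℝ :=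
  log (∑ w : Fin n → I, exp (f (List.ofFn w)))

/-- Entropy plus mean potential of the distribution of the initial word of length `n`. -/
noncomputable def blockFree [MeasurableSpace I] (f : List I → ℝ) (n : ℕ)
    (μ : Measure (ℕ → I)) : ℝ :=
  ∑ w : Fin n → I, (negMulLog (μ.real (cylinder (List.ofFn w))) +
    μ.real (cylinder (List.ofFn w)) * f (List.ofFn w))

theorem logPartition_add_le [Nonempty I] {f : List I → ℝ} (hf : ∀ u v, f (u ++ v) ≤ f u + f v)
    (a b : ℕ) : logPartition f (a + b) ≤ logPartition f a + logPartition f b := by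
  have hpos : ∀ n, 0 < ∑ w : Fin n → I, exp (f (List.ofFn w)) := fun n =>
    Finset.sum_pos (fun _ _ => exp_pos _) Finset.univ_nonempty
  simp only [logPartition]
  rw [← log_mul (hpos a).ne' (hpos b).ne']
  refine log_le_log (hpos _) ?_
  rw [sum_append, Finset.sum_mul_sum]
  refine Finset.sum_le_sum fun u _ => Finset.sum_le_sum fun v _ => ?_
  rw [List.ofFn_fin_append, ← exp_add]
  exact exp_le_exp.2 (hf _ _)

variable [MeasurableSpace I]

theorem blockFree_eq_add (f : List I → ℝ) (n : ℕ) (μ : Measure (ℕ → I)) :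
    blockFree f n μ = ∑ w : Fin n → I, negMulLog (μ.real (cylinder (List.ofFn w))) +
      ∑ w : Fin n → I, μ.real (cylinder (List.ofFn w)) * f (List.ofFn w) :=
  Finset.sum_add_distrib

theorem neg_sum_abs_le_blockFree (f : List I → ℝ) (n : ℕ) (μ : Measure (ℕ → I))
    [IsProbabilityMeasure μ] :
    -∑ w : Fin n → I, |f (List.ofFn w)| ≤ blockFree f n μ := by
  rw [← Finset.sum_neg_distrib]
  refine Finset.sum_le_sum fun w _ => ?_
  have h0 : 0 ≤ μ.real (cylinder (List.ofFn w)) := measureReal_nonneg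
  have h1 : μ.real (cylinder (List.ofFn w)) ≤ 1 := measureReal_le_one
  have h2 := negMulLog_nonneg h0 h1
  have h3 : -(|f (List.ofFn w)|) ≤ f (List.ofFn w) := neg_abs_le _
  have h4 := abs_nonneg (f (List.ofFn w))
  nlinarith

/-- Concavity of the block functional along finite averages. -/
theorem sum_blockFree_le {ι : Type*} (t : Finset ι) (c : ι → ℝ) (hc : ∀ i ∈ t, 0 ≤ c i)
    (hc1 : ∑ i ∈ t, c i = 1) (f : List I → ℝ) (n : ℕ) (ν : ι → Measure (ℕ → I))
    (μ : Measure (ℕ → I))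
    (h : ∀ w : Fin n → I, μ.real (cylinder (List.ofFn w)) =
      ∑ i ∈ t, c i * (ν i).real (cylinder (List.ofFn w))) :
    ∑ i ∈ t, c i * blockFree f n (ν i) ≤ blockFree f n μ := by
  simp only [blockFree, Finset.mul_sum]
  rw [Finset.sum_comm]
  refine Finset.sum_le_sum fun w _ => ?_
  have := concaveOn_negMulLog.le_map_sum (t := t) (w := c)
    (p := fun i => (ν i).real (cylinder (List.ofFn w))) hc hc1 fun i _ => measureReal_nonneg
  simp only [smul_eq_mul] at this
  rw [h w, Finset.sum_mul]
  simp only [mul_add, Finset.sum_add_distrib, ← mul_assoc]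
  exact add_le_add_left this _

variable [TopologicalSpace I] [DiscreteTopology I] [BorelSpace I]

theorem blockFree_le_logPartition (f : List I → ℝ) (n : ℕ) (μ : Measure (ℕ → I))
    [IsProbabilityMeasure μ] : blockFree f n μ ≤ logPartition f n :=
  sum_negMulLog_add_le_log_sum_exp _ _ (fun _ => measureReal_nonneg) (sum_measureReal_cylinder μ n)

/-- No invariance is needed: the second block is distributed according to the shifted measure.
Entropy is subadditive over the two marginals, and the potential is subadditive pointwise. -/
theorem blockFree_add_le {f : List I → ℝ} (hf : ∀ u v, f (u ++ v) ≤ f u + f v) (a b : ℕ)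
    (μ : Measure (ℕ → I)) [IsProbabilityMeasure μ] :
    blockFree f (a + b) μ ≤ blockFree f a μ + blockFree f b (μ.map shift^[a]) := by
  have hcyl : ∀ v : Fin b → I, (μ.map shift^[a]).real (cylinder (List.ofFn v)) =
      μ.real (shift^[a] ⁻¹' cylinder (List.ofFn v)) := fun v =>
    map_measureReal_apply (measurable_shift_iterate a) (measurableSet_cylinder_ofFn v)
  set r : (Fin a → I) → (Fin b → I) → ℝ :=
    fun u v => μ.real (cylinder (List.ofFn (Fin.append u v))) with hr
  have hr0 : ∀ u v, 0 ≤ r u v := fun _ _ => measureReal_nonneg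
  have hr1 : ∀ u, ∑ v, r u v = μ.real (cylinder (List.ofFn u)) := fun u => by
    simp only [hr, cylinder_append]
    exact sum_measureReal_inter_cylinder μ (measurable_shift_iterate a) _ b
  have hr2 : ∀ v, ∑ u, r u v = (μ.map shift^[a]).real (cylinder (List.ofFn v)) := fun v => by
    rw [hcyl]
    simp only [hr, cylinder_append, Set.inter_comm (cylinder _)]
    exact sum_measureReal_inter_cylinder μ measurable_id _ a
  have hent := sum_negMulLog_le_marginals r _ _ hr0 hr1 hr2 (sum_measureReal_cylinder μ a)
  have hen : ∑ u, ∑ v, r u v * f (List.ofFn (Fin.append u v)) ≤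
      ∑ u : Fin a → I, μ.real (cylinder (List.ofFn u)) * f (List.ofFn u) +
      ∑ v : Fin b → I, (μ.map shift^[a]).real (cylinder (List.ofFn v)) * f (List.ofFn v) := by
    have h1 : ∑ u, ∑ v, r u v * f (List.ofFn (Fin.append u v)) ≤
        ∑ u, ∑ v, (r u v * f (List.ofFn u) + r u v * f (List.ofFn v)) :=
      Finset.sum_le_sum fun u _ => Finset.sum_le_sum fun v _ => by
        rw [List.ofFn_fin_append, ← mul_add]
        exact mul_le_mul_of_nonneg_left (hf _ _) (hr0 u v)
    refine h1.trans_eq ?_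
    simp_rw [Finset.sum_add_distrib, ← Finset.sum_mul, hr1]
    congr 1
    rw [Finset.sum_comm]
    simp_rw [← Finset.sum_mul, hr2]
  rw [blockFree_eq_add, blockFree_eq_add, blockFree_eq_add, sum_append, sum_append]
  linarith

theorem blockFree_convexCombination_le (f : List I → ℝ) (n : ℕ) (μ₁ μ₂ μ : Measure (ℕ → I))
    [IsProbabilityMeasure μ₁] [IsProbabilityMeasure μ₂] {a b : ℝ} (ha : 0 ≤ a) (hb : 0 ≤ b)
    (h : ∀ w : Fin n → I, μ.real (cylinder (List.ofFn w)) =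
      a * μ₁.real (cylinder (List.ofFn w)) + b * μ₂.real (cylinder (List.ofFn w))) :
    blockFree f n μ ≤ a * blockFree f n μ₁ + b * blockFree f n μ₂ +
      (negMulLog a + negMulLog b) := by
  have key : ∀ w : Fin n → I, negMulLog (μ.real (cylinder (List.ofFn w))) +
      μ.real (cylinder (List.ofFn w)) * f (List.ofFn w) ≤
      a * (negMulLog (μ₁.real (cylinder (List.ofFn w))) +
        μ₁.real (cylinder (List.ofFn w)) * f (List.ofFn w)) +
      b * (negMulLog (μ₂.real (cylinder (List.ofFn w))) +
        μ₂.real (cylinder (List.ofFn w)) * f (List.ofFn w)) +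
      (μ₁.real (cylinder (List.ofFn w)) * negMulLog a +
        μ₂.real (cylinder (List.ofFn w)) * negMulLog b) := fun w => by
    have := negMulLog_convexCombination_le ha hb
      (measureReal_nonneg : 0 ≤ μ₁.real (cylinder (List.ofFn w)))
      (measureReal_nonneg : 0 ≤ μ₂.real (cylinder (List.ofFn w)))
    rw [h w]
    linarith
  refine (Finset.sum_le_sum fun w _ => key w).trans_eq ?_
  rw [Finset.sum_add_distrib, Finset.sum_add_distrib, ← Finset.mul_sum, ← Finset.mul_sum,
    Finset.sum_add_distrib (f := fun w : Fin n → I => μ₁.real (cylinder (List.ofFn w)) * _),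
    ← Finset.sum_mul, ← Finset.sum_mul, sum_measureReal_cylinder, sum_measureReal_cylinder,
    one_mul, one_mul]
  rfl

theorem blockFree_map_add_le {f : List I → ℝ} (hf : ∀ u v, f (u ++ v) ≤ f u + f v) (j a b : ℕ)
    (ν : Measure (ℕ → I)) [IsProbabilityMeasure ν] :
    blockFree f (a + b) (ν.map shift^[j]) ≤
      blockFree f a (ν.map shift^[j]) + blockFree f b (ν.map shift^[j + a]) := by
  have := isProbabilityMeasure_map_shift_iterate ν j
  refine (blockFree_add_le hf a b (ν.map shift^[j])).trans_eq ?_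
  rw [Measure.map_map (measurable_shift_iterate a) (measurable_shift_iterate j),
    ← Function.iterate_add, add_comm a j]

theorem blockFree_map_mul_le {f : List I → ℝ} (hf : ∀ u v, f (u ++ v) ≤ f u + f v) (j m k : ℕ)
    (ν : Measure (ℕ → I)) [IsProbabilityMeasure ν] :
    blockFree f (k * m) (ν.map shift^[j]) ≤ blockFree f 0 (ν.map shift^[j]) +
      ∑ i ∈ Finset.range k, blockFree f m (ν.map shift^[j + i * m]) := by
  induction k with
  | zero => simp
  | succ k ih =>
    rw [add_mul, one_mul, Finset.sum_range_succ]
    have := blockFree_map_add_le hf j (k * m) m ν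
    linarith

theorem sum_range_sum_range_add_mul (g : ℕ → ℝ) (m k : ℕ) :
    ∑ r ∈ Finset.range m, ∑ i ∈ Finset.range k, g (r + i * m) =
      ∑ j ∈ Finset.range (k * m), g j := by
  induction k with
  | zero => simp
  | succ k ih =>
    rw [add_mul, one_mul, Finset.sum_range_add, ← ih, ← Finset.sum_add_distrib]
    refine Finset.sum_congr rfl fun r _ => ?_
    rw [Finset.sum_range_succ, add_comm (k * m)]

/-- The error term of the block decomposition, which depends on the block length only. -/
noncomputable def blockError (f : List I → ℝ) (m : ℕ) : ℝ :=
  ∑ r ∈ Finset.range m, (logPartition f r + logPartition f 0 + logPartition f (m - r)) +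
    m * ∑ w : Fin m → I, |f (List.ofFn w)|

/-- For each offset `r < m`, cut the word into a head of length `r`, `k` blocks of length `m` and a
tail of length `m - r`. Over all `r`, the starting points `r + i * m` run through each `j < k * m`
exactly once; heads and tails cost a bound independent of `k` and `ν`. -/
theorem mul_blockFree_le {f : List I → ℝ} (hf : ∀ u v, f (u ++ v) ≤ f u + f v) (m k : ℕ)
    (ν : Measure (ℕ → I)) [IsProbabilityMeasure ν] :
    m * blockFree f ((k + 1) * m) ν ≤
      ∑ j ∈ Finset.range ((k + 1) * m), blockFree f m (ν.map shift^[j]) + blockError f m := by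
  have hp := isProbabilityMeasure_map_shift_iterate ν
  have hle : ∀ n j, blockFree f n (ν.map shift^[j]) ≤ logPartition f n := fun n j =>
    blockFree_le_logPartition f n _
  have key : ∀ r ∈ Finset.range m, blockFree f ((k + 1) * m) ν ≤
      (logPartition f r + logPartition f 0 + logPartition f (m - r)) +
        ∑ i ∈ Finset.range k, blockFree f m (ν.map shift^[r + i * m]) := fun r hr => by
    have hr := Finset.mem_range.1 hr
    have e : (k + 1) * m = r + (k * m + (m - r)) := by
      rw [add_mul, one_mul]; omega
    have h1 := blockFree_map_add_le hf 0 r (k * m + (m - r)) ν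
    have h2 := blockFree_map_add_le hf (0 + r) (k * m) (m - r) ν
    have h3 := blockFree_map_mul_le hf (0 + r) m k ν
    have h4 := hle r 0
    have h5 := hle (m - r) (0 + r + k * m)
    have h6 := hle 0 (0 + r)
    rw [← e] at h1
    simp only [zero_add, Function.iterate_zero, Measure.map_id] at h1 h2 h3 h4 h5 h6
    linarith
  have hsum := Finset.sum_le_sum key
  rw [Finset.sum_const, Finset.card_range, nsmul_eq_mul, Finset.sum_add_distrib,
    sum_range_sum_range_add_mul (fun j => blockFree f m (ν.map shift^[j]))] at hsum
  -- The last `m` starting points are not covered by the blocks; a crude lower bound allows them to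
  -- be added, so that the sum runs over the whole length.
  have hlast : -(m * ∑ w : Fin m → I, |f (List.ofFn w)|) ≤
      ∑ i ∈ Finset.range m, blockFree f m (ν.map shift^[k * m + i]) := by
    have := Finset.sum_le_sum fun i (_ : i ∈ Finset.range m) =>
      neg_sum_abs_le_blockFree f m (ν.map shift^[k * m + i])
    simpa using this
  rw [add_mul, one_mul, Finset.sum_range_add, blockError]
  rw [add_mul, one_mul] at hsum
  linarith

end BlockFunctional

/-! ### An invariant measure from averaged Gibbs measures -/

section Existence

variable {I : Type*} [MeasurableSpace I]

/-- The average of the first `n` push-forwards of a measure under the shift. -/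
noncomputable def shiftAverage (ν : Measure (ℕ → I)) (n : ℕ) : Measure (ℕ → I) :=
  (n : ENNReal)⁻¹ • ∑ j ∈ Finset.range n, ν.map shift^[j]

theorem shiftAverage_real (ν : Measure (ℕ → I)) [IsProbabilityMeasure ν] (n : ℕ)
    (s : Set (ℕ → I)) : (shiftAverage ν n).real s =
      ∑ j ∈ Finset.range n, (n : ℝ)⁻¹ * (ν.map shift^[j]).real s := by
  have := isProbabilityMeasure_map_shift_iterate ν
  rw [shiftAverage, measureReal_ennreal_smul_apply, measureReal_def, Measure.finsetSum_apply,
    ENNReal.toReal_sum fun _ _ => measure_ne_top _ _, Finset.mul_sum]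
  simp [measureReal_def]

theorem isProbabilityMeasure_shiftAverage (ν : Measure (ℕ → I)) [IsProbabilityMeasure ν] {n : ℕ}
    (hn : n ≠ 0) : IsProbabilityMeasure (shiftAverage ν n) := by
  have := isProbabilityMeasure_map_shift_iterate ν
  constructor
  simp [shiftAverage, Measure.finsetSum_apply, ENNReal.inv_mul_cancel, hn]

/-- The difference telescopes to its first and last terms. -/
theorem abs_shiftAverage_preimage_sub_le (ν : Measure (ℕ → I)) [IsProbabilityMeasure ν] (n : ℕ)
    {s : Set (ℕ → I)} (hs : MeasurableSet s) :
    |(shiftAverage ν n).real (shift ⁻¹' s) - (shiftAverage ν n).real s| ≤ (n : ℝ)⁻¹ := by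
  have := isProbabilityMeasure_map_shift_iterate ν
  have h1 : ∀ j, (ν.map shift^[j]).real (shift ⁻¹' s) = (ν.map shift^[j + 1]).real s := fun j => by
    rw [map_measureReal_apply (measurable_shift_iterate j) (measurable_shift hs),
      map_measureReal_apply (measurable_shift_iterate (j + 1)) hs, Function.iterate_succ']
    rfl
  rw [shiftAverage_real, shiftAverage_real, ← Finset.mul_sum, ← Finset.mul_sum, ← mul_sub,
    ← Finset.sum_sub_distrib]
  simp only [h1]
  rw [Finset.sum_range_sub fun j => (ν.map shift^[j]).real s, abs_mul,
    abs_of_nonneg (inv_nonneg.2 n.cast_nonneg)]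
  refine mul_le_of_le_one_right (inv_nonneg.2 n.cast_nonneg) (abs_sub_le_iff.2 ⟨?_, ?_⟩)
  · linarith [measureReal_le_one (μ := ν.map shift^[n]) (s := s),
      measureReal_nonneg (μ := ν.map shift^[0]) (s := s)]
  · linarith [measureReal_le_one (μ := ν.map shift^[0]) (s := s),
      measureReal_nonneg (μ := ν.map shift^[n]) (s := s)]

theorem continuous_shift {I : Type*} [TopologicalSpace I] :
    Continuous (shift : (ℕ → I) → ℕ → I) :=
  continuous_pi fun n => continuous_apply (n + 1)

variable [Fintype I] [TopologicalSpace I] [DiscreteTopology I] [BorelSpace I]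

theorem exists_measure_real_cylinder_eq [Nonempty I] {n : ℕ} (q : (Fin n → I) → ℝ)
    (hq : ∀ w, 0 ≤ q w) (hq1 : ∑ w, q w = 1) :
    ∃ ν : Measure (ℕ → I), IsProbabilityMeasure ν ∧
      ∀ w, ν.real (cylinder (List.ofFn w)) = q w := by
  have hsum : ∑ w, ENNReal.ofReal (q w) = 1 := by
    rw [← ENNReal.ofReal_sum_of_nonneg fun w _ => hq w, hq1, ENNReal.ofReal_one]
  let g : (Fin n → I) → ℕ → I := fun w => prepend (List.ofFn w) fun _ => Classical.arbitrary I
  have hg : Measurable g := measurable_of_finite g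
  refine ⟨((PMF.ofFintype _ hsum).toMeasure).map g,
    Measure.isProbabilityMeasure_map hg.aemeasurable, fun w => ?_⟩
  -- Each word carries one atom, at its extension by a constant tail, so a cylinder of length `n`
  -- contains exactly one of these atoms.
  have hpre : g ⁻¹' cylinder (List.ofFn w) = {w} := by
    ext v
    rw [Set.mem_preimage, mem_cylinder_ofFn, Set.mem_singleton_iff]
    have : (fun i : Fin n => g v i) = v := by
      funext i
      simp [g, prepend]
    rw [this]
  rw [map_measureReal_apply hg (measurableSet_cylinder_ofFn w), hpre, measureReal_def,
    PMF.toMeasure_apply_singleton _ _ (measurableSet_singleton w), PMF.ofFintype_apply,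
    ENNReal.toReal_ofReal (hq w)]

theorem exists_blockFree_eq_logPartition [Nonempty I] (f : List I → ℝ) (n : ℕ) :
    ∃ ν : Measure (ℕ → I), IsProbabilityMeasure ν ∧ blockFree f n ν = logPartition f n := by
  have hZ : 0 < ∑ w : Fin n → I, Real.exp (f (List.ofFn w)) :=
    Finset.sum_pos (fun _ _ => Real.exp_pos _) Finset.univ_nonempty
  obtain ⟨ν, hν, h⟩ := exists_measure_real_cylinder_eq
    (fun w : Fin n → I => Real.exp (f (List.ofFn w)) / ∑ w : Fin n → I, Real.exp (f (List.ofFn w)))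
    (fun w => (div_pos (Real.exp_pos _) hZ).le) (by rw [← Finset.sum_div, div_self hZ.ne'])
  refine ⟨ν, hν, ?_⟩
  simp only [blockFree, h]
  exact sum_negMulLog_gibbs _

theorem tendsto_real_of_isClopen {ι : Type*} {l : Filter ι} {p : ι → ProbabilityMeasure (ℕ → I)}
    {μ : ProbabilityMeasure (ℕ → I)} (h : Tendsto p l (𝓝 μ)) {s : Set (ℕ → I)} (hs : IsClopen s) :
    Tendsto (fun i => (p i : Measure (ℕ → I)).real s) l (𝓝 ((μ : Measure (ℕ → I)).real s)) := by
  have := ProbabilityMeasure.tendsto_measure_of_isClopen_of_tendsto h hs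
  exact (NNReal.continuous_coe.tendsto _).comp this

/-- The functional involves finitely many cylinders, and cylinders are clopen, so weak convergence
passes to their masses. -/
theorem tendsto_blockFree {ι : Type*} {l : Filter ι} {p : ι → ProbabilityMeasure (ℕ → I)}
    {μ : ProbabilityMeasure (ℕ → I)} (h : Tendsto p l (𝓝 μ)) (f : List I → ℝ) (n : ℕ) :
    Tendsto (fun i => blockFree f n (p i : Measure (ℕ → I))) l (𝓝 (blockFree f n μ)) := by
  refine tendsto_finsetSum _ fun w _ => ?_
  have := tendsto_real_of_isClopen h (isClopen_cylinder_ofFn w)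
  exact ((Real.continuous_negMulLog.tendsto _).comp this).add (this.mul_const _)

/-- Existence of an invariant measure whose block functionals dominate the pressure. -/
theorem exists_invariant_le_blockFree [Nonempty I] {f : List I → ℝ}
    (hf : ∀ u v, f (u ++ v) ≤ f u + f v) {P : ℝ}
    (hP : ∀ n : ℕ, n ≠ 0 → n * P ≤ logPartition f n) :
    ∃ μ : ProbabilityMeasure (ℕ → I), (μ : Measure (ℕ → I)).map shift = μ ∧
      ∀ n : ℕ, n ≠ 0 → n * P ≤ blockFree f n μ := by
  choose ν hν hνP using exists_blockFree_eq_logPartition (I := I) f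
  -- Factorial lengths make every fixed `m ≠ 0` divide all later lengths, so the block decomposition
  -- leaves no remainder.
  let p : ℕ → ProbabilityMeasure (ℕ → I) := fun k =>
    ⟨shiftAverage (ν k.factorial) k.factorial,
      isProbabilityMeasure_shiftAverage _ k.factorial_ne_zero⟩
  let U : Ultrafilter ℕ := hyperfilter ℕ
  have hU : (U : Filter ℕ) ≤ atTop := Nat.hyperfilter_le_atTop
  obtain ⟨μ, -, hμ⟩ := isCompact_univ.ultrafilter_le_nhds (U.map p) (by simp)
  replace hμ : Tendsto p U (𝓝 μ) := hμ
  have hfac : Tendsto (fun k : ℕ => ((k.factorial : ℕ) : ℝ)⁻¹) U (𝓝 0) :=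
    (tendsto_inv_atTop_zero.comp (tendsto_natCast_atTop_atTop.comp
      (tendsto_atTop_mono Nat.self_le_factorial tendsto_id))).mono_left hU
  refine ⟨μ, ?_, fun m hm => ?_⟩
  · have := Measure.isProbabilityMeasure_map (μ := (μ : Measure (ℕ → I)))
      measurable_shift.aemeasurable
    refine measure_ext_cylinder fun n w => ?_
    rw [map_measureReal_apply measurable_shift (measurableSet_cylinder_ofFn w)]
    have h1 := tendsto_real_of_isClopen hμ ((isClopen_cylinder_ofFn w).preimage continuous_shift)
    have h2 := tendsto_real_of_isClopen hμ (isClopen_cylinder_ofFn w)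
    have h3 := squeeze_zero_norm (f := fun k => (p k : Measure (ℕ → I)).real
        (shift ⁻¹' cylinder (List.ofFn w)) - (p k : Measure (ℕ → I)).real (cylinder (List.ofFn w)))
      (fun k => abs_shiftAverage_preimage_sub_le (ν k.factorial)
      k.factorial (measurableSet_cylinder_ofFn w)) hfac
    exact sub_eq_zero.1 (tendsto_nhds_unique (h1.sub h2) h3)
  · have h1 : Tendsto (fun k => blockFree f m (p k : Measure (ℕ → I)) +
        (k.factorial : ℝ)⁻¹ * blockError f m) U (𝓝 (blockFree f m μ + 0 * blockError f m)) :=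
      (tendsto_blockFree hμ f m).add (hfac.mul_const _)
    rw [zero_mul, add_zero] at h1
    refine ge_of_tendsto h1 (hU ?_)
    filter_upwards [eventually_ge_atTop m] with k hk
    obtain ⟨l, hl⟩ := Nat.dvd_factorial (Nat.pos_of_ne_zero hm) hk
    obtain ⟨l, rfl⟩ : ∃ l', l = l' + 1 := Nat.exists_eq_succ_of_ne_zero fun h =>
      k.factorial_ne_zero (by rw [hl, h, mul_zero])
    have hN : (0 : ℝ) < k.factorial := by exact_mod_cast k.factorial_pos
    have h2 := mul_blockFree_le hf m l (ν k.factorial)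
    rw [mul_comm (l + 1) m, ← hl, hνP] at h2
    -- Concavity bounds the mean of the functional over the shifted measures by its value at their
    -- average.
    have h3 : ∑ j ∈ Finset.range k.factorial,
        blockFree f m ((ν k.factorial).map shift^[j]) ≤
        k.factorial * blockFree f m (p k : Measure (ℕ → I)) := by
      have := sum_blockFree_le (Finset.range k.factorial) (fun _ => (k.factorial : ℝ)⁻¹)
        (fun _ _ => inv_nonneg.2 hN.le) (by simp [hN.ne']) f m
        (fun j => (ν k.factorial).map shift^[j]) (p k : Measure (ℕ → I))
        fun w => shiftAverage_real _ _ _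
      rw [← Finset.mul_sum, inv_mul_le_iff₀ hN] at this
      exact this
    have h4 := mul_le_mul_of_nonneg_left (hP _ k.factorial_ne_zero) (m.cast_nonneg (α := ℝ))
    refine le_of_mul_le_mul_left ?_ hN
    rw [mul_add, mul_inv_cancel_left₀ hN.ne']
    linarith

end Existence

/-! ### From invariant to ergodic by an extreme point -/

section Ergodicity

theorem map_cond_of_preimage_eq {α : Type*} [MeasurableSpace α] {g : α → α} (hg : Measurable g)
    {μ : Measure α} (hμ : μ.map g = μ) {s : Set α} (hs : MeasurableSet s) (hgs : g ⁻¹' s = s) :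
    (ProbabilityTheory.cond μ s).map g = ProbabilityTheory.cond μ s := by
  ext t ht
  rw [Measure.map_apply hg ht, ProbabilityTheory.cond_apply hs, ProbabilityTheory.cond_apply hs]
  nth_rw 2 [← hgs]
  rw [← Set.preimage_inter, ← Measure.map_apply hg (hs.inter ht), hμ]

theorem measureReal_mul_cond {α : Type*} [MeasurableSpace α] {μ : Measure α}
    [IsFiniteMeasure μ] {s : Set α} (hs : MeasurableSet s) (h0 : μ s ≠ 0) (t : Set α) :
    μ.real s * (ProbabilityTheory.cond μ s).real t = μ.real (s ∩ t) := by
  have h0' : μ.real s ≠ 0 := (measureReal_ne_zero_iff).2 h0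
  rw [measureReal_def (ProbabilityTheory.cond μ s), ProbabilityTheory.cond_apply hs,
    ENNReal.toReal_mul, ENNReal.toReal_inv]
  exact mul_inv_cancel_left₀ h0' _

theorem map_shift_iterate_of_invariant {I : Type*} [MeasurableSpace I] {μ : Measure (ℕ → I)}
    (h : μ.map shift = μ) (j : ℕ) : μ.map shift^[j] = μ := by
  induction j with
  | zero => simp
  | succ j ih =>
    rw [Function.iterate_succ, ← Measure.map_map (measurable_shift_iterate j) measurable_shift, h,
      ih]

theorem ergodic_dirac_of_fixed {I : Type*} [MeasurableSpace I] {x : ℕ → I} (hx : shift x = x) :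
    Ergodic shift (Measure.dirac x) := by
  refine ⟨⟨measurable_shift, by rw [Measure.map_dirac' measurable_shift, hx]⟩, ⟨fun s hs _ => ?_⟩⟩
  rw [eventuallyConst_set', ae_eq_empty, ae_eq_univ, Measure.dirac_apply' _ hs,
    Measure.dirac_apply' _ hs.compl]
  by_cases h : x ∈ s <;> simp [h]

variable {I : Type*} [Fintype I] [MeasurableSpace I]
  [TopologicalSpace I] [DiscreteTopology I] [BorelSpace I]

theorem subadditive_blockFree {f : List I → ℝ} (hf : ∀ u v, f (u ++ v) ≤ f u + f v)
    {μ : Measure (ℕ → I)} [IsProbabilityMeasure μ] (h : μ.map shift = μ) :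
    Subadditive fun n => blockFree f n μ := fun a b => by
  have := blockFree_add_le hf a b μ
  rwa [map_shift_iterate_of_invariant h] at this

/-- The invariant measures that dominate the pressure form a face of the invariant measures. -/
theorem le_blockFree_of_convexCombination {f : List I → ℝ} (hf : ∀ u v, f (u ++ v) ≤ f u + f v)
    {P : ℝ} (hP : Tendsto (fun n : ℕ => logPartition f n / n) atTop (𝓝 P))
    {μ μ₁ μ₂ : Measure (ℕ → I)} [IsProbabilityMeasure μ₁] [IsProbabilityMeasure μ₂]
    (hμ : ∀ n : ℕ, n ≠ 0 → n * P ≤ blockFree f n μ) (hμ₁ : μ₁.map shift = μ₁) {a b : ℝ}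
    (ha : 0 < a) (hb : 0 < b) (hab : a + b = 1)
    (h : ∀ (n : ℕ) (w : Fin n → I), μ.real (cylinder (List.ofFn w)) =
      a * μ₁.real (cylinder (List.ofFn w)) + b * μ₂.real (cylinder (List.ofFn w)))
    {m : ℕ} (hm : m ≠ 0) : m * P ≤ blockFree f m μ₁ := by
  by_contra! hlt
  have hm' : (0 : ℝ) < m := by positivity
  -- If `μ₁` fails at one length `m`, subadditivity keeps its block averages below some `L < P` at
  -- all large lengths.
  obtain ⟨L, hL1, hL2⟩ : ∃ L, blockFree f m μ₁ / m < L ∧ L < P :=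
    exists_between ((div_lt_iff₀ hm').2 (by linarith))
  have hev := (subadditive_blockFree hf hμ₁).eventually_div_lt_of_div_lt hm hL1
  set C := Real.negMulLog a + Real.negMulLog b
  have hlim : Tendsto (fun n : ℕ => a * L + b * (logPartition f n / n) + C * (n : ℝ)⁻¹) atTop
      (𝓝 (a * L + b * P + C * 0)) :=
    (tendsto_const_nhds.add (hP.const_mul b)).add
      (tendsto_inv_atTop_nhds_zero_nat.const_mul C)
  -- The `μ₂` part needs only the universal bound by `logPartition`, whose rate is `P`; the mixing
  -- entropy `C` vanishes after division by `n`. As `a > 0` and `a + b = 1`, this contradicts `L <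
  -- P`.
  have hle : P ≤ a * L + b * P + C * 0 := by
    refine ge_of_tendsto hlim ?_
    filter_upwards [hev, eventually_ne_atTop 0] with n hn hn0
    have hn' : (0 : ℝ) < n := by positivity
    have h1 := blockFree_convexCombination_le f n μ₁ μ₂ μ ha.le hb.le (h n)
    have h2 := hμ n hn0
    have h3 := mul_le_mul_of_nonneg_left ((div_lt_iff₀ hn').1 hn).le ha.le
    have h4 := mul_le_mul_of_nonneg_left (blockFree_le_logPartition f n μ₂) hb.le
    refine le_of_mul_le_mul_left ?_ hn'
    have h5 : (n : ℝ) * (a * L + b * (logPartition f n / n) + C * (n : ℝ)⁻¹) =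
        a * (L * n) + b * logPartition f n + C := by
      field_simp
    rw [h5]
    linarith
  have hb' : b = 1 - a := by linarith
  subst hb'
  nlinarith

theorem isClosed_invariant_le_blockFree (f : List I → ℝ) (P : ℝ) :
    IsClosed {μ : ProbabilityMeasure (ℕ → I) | (μ : Measure (ℕ → I)).map shift = μ ∧
      ∀ n : ℕ, n ≠ 0 → n * P ≤ blockFree f n (μ : Measure (ℕ → I))} := by
  refine isClosed_iff_ultrafilter.2 fun μ U hU hmem => ⟨?_, fun n hn => ?_⟩
  · have := Measure.isProbabilityMeasure_map (μ := (μ : Measure (ℕ → I)))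
      measurable_shift.aemeasurable
    refine measure_ext_cylinder fun n w => ?_
    rw [map_measureReal_apply measurable_shift (measurableSet_cylinder_ofFn w)]
    have h1 := tendsto_real_of_isClopen (p := id) (l := U) (tendsto_id'.2 hU)
      ((isClopen_cylinder_ofFn w).preimage continuous_shift)
    have h2 := tendsto_real_of_isClopen (p := id) (l := U) (tendsto_id'.2 hU) (isClopen_cylinder_ofFn w)
    refine tendsto_nhds_unique h1 (h2.congr' ?_)
    filter_upwards [hmem] with ν hν
    rw [id, ← map_measureReal_apply measurable_shift (measurableSet_cylinder_ofFn w), hν.1]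
  · refine ge_of_tendsto (tendsto_blockFree (p := id) (l := U) (tendsto_id'.2 hU) f n) ?_
    filter_upwards [hmem] with ν hν
    exact hν.2 n hn

/-- Existence of an ergodic measure whose block functionals dominate the pressure. -/
theorem exists_ergodic_le_blockFree [Nonempty I] {f : List I → ℝ}
    (hf : ∀ u v, f (u ++ v) ≤ f u + f v) {P : ℝ}
    (hP : ∀ n : ℕ, n ≠ 0 → n * P ≤ logPartition f n)
    (hlim : Tendsto (fun n : ℕ => logPartition f n / n) atTop (𝓝 P)) :
    ∃ μ : Measure (ℕ → I), IsProbabilityMeasure μ ∧ Ergodic shift μ ∧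
      ∀ n : ℕ, n ≠ 0 → n * P ≤ blockFree f n μ := by
  -- Cylinder masses embed the measures into a real product space, where the Krein–Milman theorem
  -- supplies an extreme point.
  let Φ : ProbabilityMeasure (ℕ → I) → (Σ n, Fin n → I) → ℝ :=
    fun μ w => (μ : Measure (ℕ → I)).real (cylinder (List.ofFn w.2))
  have hΦ : Continuous Φ := continuous_pi fun w => continuous_iff_continuousAt.2 fun μ =>
    tendsto_real_of_isClopen (p := id) tendsto_id (isClopen_cylinder_ofFn w.2)
  set S := {μ : ProbabilityMeasure (ℕ → I) | (μ : Measure (ℕ → I)).map shift = μ ∧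
      ∀ n : ℕ, n ≠ 0 → n * P ≤ blockFree f n (μ : Measure (ℕ → I))} with hS
  have hcomp : IsCompact (Φ '' S) :=
    (isClosed_invariant_le_blockFree f P).isCompact.image hΦ
  have hne : (Φ '' S).Nonempty := by
    obtain ⟨μ, hμ⟩ := exists_invariant_le_blockFree hf hP
    exact ⟨_, μ, hμ, rfl⟩
  obtain ⟨x, hx⟩ := hcomp.extremePoints_nonempty hne
  obtain ⟨⟨μ, hμ, rfl⟩, hext⟩ := mem_extremePoints.1 hx
  refine ⟨μ, inferInstance, ⟨⟨measurable_shift, hμ.1⟩, ⟨fun s hs hss => ?_⟩⟩, hμ.2⟩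
  rw [eventuallyConst_set', ae_eq_empty, ae_eq_univ]
  by_contra! hcon
  obtain ⟨h1, h2⟩ := hcon
  have hp1 := ProbabilityTheory.cond_isProbabilityMeasure h1
  have hp2 := ProbabilityTheory.cond_isProbabilityMeasure h2
  have hi1 := map_cond_of_preimage_eq measurable_shift hμ.1 hs hss
  have hi2 := map_cond_of_preimage_eq measurable_shift hμ.1 hs.compl
    (by rw [Set.preimage_compl, hss])
  have ha : 0 < (μ : Measure (ℕ → I)).real s :=
    measureReal_nonneg.lt_of_ne' ((measureReal_ne_zero_iff).2 h1)
  have hb : 0 < (μ : Measure (ℕ → I)).real sᶜ :=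
    measureReal_nonneg.lt_of_ne' ((measureReal_ne_zero_iff).2 h2)
  have hab : (μ : Measure (ℕ → I)).real s + (μ : Measure (ℕ → I)).real sᶜ = 1 :=
    probReal_add_probReal_compl hs
  -- A nontrivial invariant set splits `μ` into its two conditional measures, both in `S` by the
  -- face property; extremality makes the first equal to `μ`, yet it gives `sᶜ` mass zero.
  have hdec : ∀ t, (μ : Measure (ℕ → I)).real t =
      (μ : Measure (ℕ → I)).real s * (ProbabilityTheory.cond (μ : Measure (ℕ → I)) s).real t +
      (μ : Measure (ℕ → I)).real sᶜ *
        (ProbabilityTheory.cond (μ : Measure (ℕ → I)) sᶜ).real t := fun t => by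
    rw [measureReal_mul_cond hs h1, measureReal_mul_cond hs.compl h2, Set.inter_comm s,
      Set.inter_comm sᶜ, ← Set.sdiff_eq, measureReal_inter_add_sdiff hs]
  let μ₁ : ProbabilityMeasure (ℕ → I) := ⟨_, hp1⟩
  let μ₂ : ProbabilityMeasure (ℕ → I) := ⟨_, hp2⟩
  have hm1 : μ₁ ∈ S := ⟨hi1, fun n hn => le_blockFree_of_convexCombination hf hlim hμ.2 hi1 ha hb
    hab (fun n w => hdec _) hn⟩
  have hm2 : μ₂ ∈ S := ⟨hi2, fun n hn => le_blockFree_of_convexCombination hf hlim hμ.2 hi2 hb ha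
    (by rw [add_comm, hab]) (fun n w => by rw [add_comm]; exact hdec _) hn⟩
  have heq := (hext _ ⟨μ₁, hm1, rfl⟩ _ ⟨μ₂, hm2, rfl⟩
    ⟨_, _, ha, hb, hab, funext fun w => (hdec _).symm⟩).1
  have heq' : (μ₁ : Measure (ℕ → I)) = μ :=
    measure_ext_cylinder fun n w => congrFun heq ⟨n, w⟩
  have h3 : (μ₁ : Measure (ℕ → I)) sᶜ = 0 := by
    change ProbabilityTheory.cond (μ : Measure (ℕ → I)) s sᶜ = 0
    rw [ProbabilityTheory.cond_apply hs, Set.inter_compl_self, measure_empty, mul_zero]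
  exact h2 (heq' ▸ h3)

end Ergodicity

/-! ### Extended-real limits and the passage from `ψ` to the potential -/

section Pressure

/-- Adding a real null sequence is continuous even at infinite limits, so errors bounded before
division by `n` are harmless there too. -/
theorem tendsto_coe_of_abs_sub_le {x y : ℕ → ℝ} {p : EReal} {C : ℝ}
    (hx : Tendsto (fun n => (x n : EReal)) atTop (𝓝 p))
    (h : ∀ n : ℕ, n ≠ 0 → |y n - x n| ≤ C * (n : ℝ)⁻¹) :
    Tendsto (fun n => (y n : EReal)) atTop (𝓝 p) := by
  have h0 : Tendsto (fun n => y n - x n) atTop (𝓝 0) := by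
    refine squeeze_zero_norm' ?_ (by
      simpa using (tendsto_inv_atTop_nhds_zero_nat (𝕜 := ℝ)).const_mul C)
    filter_upwards [eventually_ne_atTop 0] with n hn using h n hn
  have h1 : Tendsto (fun n => ((y n - x n : ℝ) : EReal)) atTop (𝓝 ((0 : ℝ) : EReal)) :=
    (continuous_coe_real_ereal.tendsto _).comp h0
  have h2 := (EReal.continuousAt_add (p := (p, ((0 : ℝ) : EReal))) (Or.inr (by simp))
    (Or.inr (by simp))).tendsto.comp (hx.prodMk_nhds h1)
  simp only [EReal.coe_zero, add_zero] at h2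
  refine h2.congr fun n => ?_
  simp only [Function.comp]
  rw [← EReal.coe_add]
  congr 1
  ring

/-- Fekete's lemma in the extended reals. -/
theorem exists_tendsto_div_of_subadditive {u : ℕ → ℝ} (hu : Subadditive u) :
    Tendsto (fun n => ((u n / n : ℝ) : EReal)) atTop (𝓝 ⊥) ∨
      ∃ P : ℝ, Tendsto (fun n => u n / n) atTop (𝓝 P) ∧ ∀ n : ℕ, n ≠ 0 → n * P ≤ u n := by
  by_cases hb : BddBelow (Set.range fun n => u n / n)
  · refine Or.inr ⟨hu.lim, hu.tendsto_lim hb, fun n hn => ?_⟩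
    have hn' : (0 : ℝ) < n := by positivity
    have := hu.lim_le_div hb hn
    rw [le_div_iff₀ hn'] at this
    linarith
  · refine Or.inl (EReal.tendsto_nhds_bot_iff_real.2 fun x => ?_)
    rw [not_bddBelow_iff] at hb
    -- The minimum with `0` excludes `n = 0`, where the quotient is `0` by convention.
    obtain ⟨_, ⟨n, rfl⟩, hn⟩ := hb (min x 0)
    have hn0 : n ≠ 0 := by
      rintro rfl
      simp at hn
    filter_upwards [hu.eventually_div_lt_of_div_lt hn0 (hn.trans_le (min_le_left _ _))] with m hm
    exact EReal.coe_lt_coe hm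

theorem abs_one_div_mul_sub_div_le {a b C : ℝ} {n : ℕ} (h : |a - b| ≤ C) :
    |1 / (n : ℝ) * a - b / n| ≤ C * (n : ℝ)⁻¹ := by
  have : 1 / (n : ℝ) * a - b / n = (a - b) * (n : ℝ)⁻¹ := by ring
  rw [this, abs_mul, abs_of_nonneg (inv_nonneg.2 (n.cast_nonneg (α := ℝ)))]
  exact mul_le_mul_of_nonneg_right h (inv_nonneg.2 n.cast_nonneg)

variable {I : Type*}

open Classical in
/-- The subadditive potential on words attached to a cylinder function. -/
noncomputable def potential (φ : List I → (ℕ → I) → ℝ) (K : ℝ) (h₀ : ℕ → I) (w : List I) : ℝ :=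
  if w = [] then 0 else Real.log K + Real.log (φ w h₀)

/-- The subchain rule evaluates the first factor at a shifted base point; returning to `h₀` costs
one factor `K`, which the term `log K` in the potential absorbs. -/
theorem IsCylinderFunction.potential_append_le {ψ : ℝ≥0 → List I → (ℕ → I) → ℝ}
    (hψ : IsCylinderFunction ψ) {t : ℝ≥0} {K : ℝ} (hK : 1 ≤ K)
    (hbv : ∀ w : List I, w ≠ [] → ∀ h j : ℕ → I, ψ t w h ≤ K * ψ t w j) (h₀ : ℕ → I)
    (u v : List I) :
    potential (ψ t) K h₀ (u ++ v) ≤ potential (ψ t) K h₀ u + potential (ψ t) K h₀ v := by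
  rcases eq_or_ne u [] with rfl | hu
  · simp [potential]
  rcases eq_or_ne v [] with rfl | hv
  · simp [potential]
  have huv : u ++ v ≠ [] := by simp [hu]
  have hK0 : 0 < K := by linarith
  have hlu := List.length_pos_iff.2 hu
  have hlv := List.length_pos_iff.2 hv
  have h1 := hψ.subchain t (u ++ v) u.length hlu (by rw [List.length_append]; omega) h₀
  rw [List.take_left, List.drop_left] at h1
  have hpu := hψ.pos t u hu h₀
  have hpv := hψ.pos t v hv h₀
  have h2 : ψ t (u ++ v) h₀ ≤ K * ψ t u h₀ * ψ t v h₀ :=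
    h1.trans (mul_le_mul_of_nonneg_right (hbv u hu _ _) hpv.le)
  have h3 := Real.log_le_log (hψ.pos t _ huv h₀) h2
  rw [Real.log_mul (mul_pos hK0 hpu).ne' hpv.ne', Real.log_mul hK0.ne' hpu.ne'] at h3
  simp only [potential, hu, hv, huv, if_false]
  linarith

theorem abs_log_sub_potential_le {ψ : ℝ≥0 → List I → (ℕ → I) → ℝ}
    (hψ : IsCylinderFunction ψ) {t : ℝ≥0} {K : ℝ} (hK : 1 ≤ K)
    (hbv : ∀ w : List I, w ≠ [] → ∀ h j : ℕ → I, ψ t w h ≤ K * ψ t w j) (h₀ h : ℕ → I)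
    {w : List I} (hw : w ≠ []) :
    |Real.log (ψ t w h) - potential (ψ t) K h₀ w| ≤ 2 * Real.log K := by
  have hK0 : 0 < K := by linarith
  have h1 := Real.log_le_log (hψ.pos t w hw h) (hbv w hw h h₀)
  have h2 := Real.log_le_log (hψ.pos t w hw h₀) (hbv w hw h₀ h)
  rw [Real.log_mul hK0.ne' (hψ.pos t w hw _).ne'] at h1 h2
  have h3 := Real.log_nonneg hK
  simp only [potential, hw, if_false]
  rw [abs_le]
  constructor <;> linarith

theorem ofFn_ne_nil {n : ℕ} (hn : n ≠ 0) (w : Fin n → I) : List.ofFn w ≠ [] := by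
  rwa [Ne, List.ofFn_eq_nil_iff]

variable [Fintype I]

theorem abs_log_sum_sub_logPartition_le [Nonempty I] {ψ : ℝ≥0 → List I → (ℕ → I) → ℝ}
    (hψ : IsCylinderFunction ψ) {t : ℝ≥0} {K : ℝ} (hK : 1 ≤ K)
    (hbv : ∀ w : List I, w ≠ [] → ∀ h j : ℕ → I, ψ t w h ≤ K * ψ t w j) (h₀ h : ℕ → I)
    {n : ℕ} (hn : n ≠ 0) :
    |Real.log (∑ w : Fin n → I, ψ t (List.ofFn w) h) - logPartition (potential (ψ t) K h₀) n| ≤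
      2 * Real.log K := by
  have hpos : ∀ w : Fin n → I, 0 < ψ t (List.ofFn w) h := fun w => hψ.pos t _ (ofFn_ne_nil hn w) h
  have hexp : ∀ w : Fin n → I, ψ t (List.ofFn w) h = Real.exp (Real.log (ψ t (List.ofFn w) h)) :=
    fun w => (Real.exp_log (hpos w)).symm
  have hb := fun w : Fin n → I =>
    abs_le.1 (abs_log_sub_potential_le hψ hK hbv h₀ h (ofFn_ne_nil hn w))
  have h1 : 0 < ∑ w : Fin n → I, ψ t (List.ofFn w) h :=
    Finset.sum_pos (fun w _ => hpos w) Finset.univ_nonempty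
  have h2 : 0 < ∑ w : Fin n → I, Real.exp (potential (ψ t) K h₀ (List.ofFn w)) :=
    Finset.sum_pos (fun w _ => Real.exp_pos _) Finset.univ_nonempty
  have h3 : ∑ w : Fin n → I, ψ t (List.ofFn w) h ≤ Real.exp (2 * Real.log K) *
      ∑ w : Fin n → I, Real.exp (potential (ψ t) K h₀ (List.ofFn w)) := by
    rw [Finset.mul_sum]
    refine Finset.sum_le_sum fun w _ => ?_
    rw [hexp, ← Real.exp_add]
    exact Real.exp_le_exp.2 (by linarith [(hb w).2])
  have h4 : ∑ w : Fin n → I, Real.exp (potential (ψ t) K h₀ (List.ofFn w)) ≤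
      Real.exp (2 * Real.log K) * ∑ w : Fin n → I, ψ t (List.ofFn w) h := by
    rw [Finset.mul_sum]
    refine Finset.sum_le_sum fun w _ => ?_
    rw [hexp, ← Real.exp_add]
    exact Real.exp_le_exp.2 (by linarith [(hb w).1])
  have h5 := Real.log_le_log h1 h3
  have h6 := Real.log_le_log h2 h4
  rw [Real.log_mul (Real.exp_pos _).ne' h2.ne', Real.log_exp] at h5
  rw [Real.log_mul (Real.exp_pos _).ne' h1.ne', Real.log_exp] at h6
  rw [logPartition, abs_le]
  constructor <;> linarith

theorem hasPressure_of_tendsto [Nonempty I] {ψ : ℝ≥0 → List I → (ℕ → I) → ℝ}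
    (hψ : IsCylinderFunction ψ) {t : ℝ≥0} {K : ℝ} (hK : 1 ≤ K)
    (hbv : ∀ w : List I, w ≠ [] → ∀ h j : ℕ → I, ψ t w h ≤ K * ψ t w j) (h₀ : ℕ → I) {p : EReal}
    (hp : Tendsto (fun n : ℕ => ((logPartition (potential (ψ t) K h₀) n / n : ℝ) : EReal))
      atTop (𝓝 p)) : HasPressure ψ t p := fun h =>
  tendsto_coe_of_abs_sub_le hp fun _ hn =>
    abs_one_div_mul_sub_div_le (abs_log_sum_sub_logPartition_le hψ hK hbv h₀ h hn)

theorem HasPressure.bot_lt [Nonempty I] {ψ : ℝ≥0 → List I → (ℕ → I) → ℝ} {t : ℝ≥0} {p : EReal}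
    (hp : HasPressure ψ t p) {c : ℝ} (hc : 0 < c)
    (h : ∀ w : List I, w ≠ [] → ∀ h : ℕ → I, c ^ w.length ≤ ψ t w h) : ⊥ < p := by
  let h₀ : ℕ → I := fun _ => Classical.arbitrary I
  refine (EReal.bot_lt_coe (Real.log c)).trans_le (ge_of_tendsto (hp h₀) ?_)
  filter_upwards [eventually_ne_atTop 0] with n hn
  have hn' : (0 : ℝ) < n := by positivity
  refine EReal.coe_le_coe ?_
  have hle : ∀ w : Fin n → I, c ^ n ≤ ψ t (List.ofFn w) h₀ := fun w => by
    simpa using h _ (ofFn_ne_nil hn w) h₀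
  have h1 : c ^ n ≤ ∑ w : Fin n → I, ψ t (List.ofFn w) h₀ :=
    (hle fun _ => Classical.arbitrary I).trans (Finset.single_le_sum
      (f := fun w : Fin n → I => ψ t (List.ofFn w) h₀)
      (fun w _ => (pow_pos hc n).le.trans (hle w)) (Finset.mem_univ _))
  have h2 := Real.log_le_log (pow_pos hc n) h1
  rw [Real.log_pow] at h2
  rw [one_div, ← div_eq_inv_mul, le_div_iff₀ hn']
  linarith

theorem sum_negMulLog_cylinder_nonneg [MeasurableSpace I] (μ : Measure (ℕ → I)) [IsProbabilityMeasure μ]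
    (n : ℕ) : 0 ≤ ∑ w : Fin n → I, Real.negMulLog (μ.real (cylinder (List.ofFn w))) :=
  Finset.sum_nonneg fun _ _ => Real.negMulLog_nonneg measureReal_nonneg measureReal_le_one

variable [MeasurableSpace I] [TopologicalSpace I] [DiscreteTopology I] [BorelSpace I]

theorem hasEnergy_of_tendsto {ψ : ℝ≥0 → List I → (ℕ → I) → ℝ}
    (hψ : IsCylinderFunction ψ) {t : ℝ≥0} {K : ℝ} (hK : 1 ≤ K)
    (hbv : ∀ w : List I, w ≠ [] → ∀ h j : ℕ → I, ψ t w h ≤ K * ψ t w j) (h₀ : ℕ → I) {e : EReal}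
    {μ : Measure (ℕ → I)} [IsProbabilityMeasure μ]
    (he : Tendsto (fun n : ℕ => (((∑ w : Fin n → I, μ.real (cylinder (List.ofFn w)) *
      potential (ψ t) K h₀ (List.ofFn w)) / n : ℝ) : EReal)) atTop (𝓝 e)) :
    HasEnergy ψ t μ e := fun h => by
  refine tendsto_coe_of_abs_sub_le he fun n hn => abs_one_div_mul_sub_div_le ?_
    (C := 2 * Real.log K)
  rw [← Finset.sum_sub_distrib]
  refine (Finset.abs_sum_le_sum_abs _ _).trans ?_
  rw [← one_mul (2 * Real.log K), ← sum_measureReal_cylinder μ n, Finset.sum_mul]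
  refine Finset.sum_le_sum fun w _ => ?_
  rw [← mul_sub, abs_mul, abs_of_nonneg measureReal_nonneg]
  exact mul_le_mul_of_nonneg_left
    (abs_log_sub_potential_le hψ hK hbv h₀ h (ofFn_ne_nil hn w)) measureReal_nonneg

theorem exists_hasEntropy {μ : Measure (ℕ → I)} [IsProbabilityMeasure μ] (h : μ.map shift = μ) :
    ∃ s, HasEntropy μ s := by
  -- With zero potential the block functional is the block entropy.
  have hsub := subadditive_blockFree (f := fun _ => 0) (by simp) h
  simp only [blockFree, mul_zero, add_zero] at hsub
  refine ⟨hsub.lim, (hsub.tendsto_lim ⟨0, ?_⟩).congr fun n => by ring⟩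
  rintro _ ⟨n, rfl⟩
  exact div_nonneg (sum_negMulLog_cylinder_nonneg μ n) n.cast_nonneg

theorem hasEntropy_dirac (x : ℕ → I) : HasEntropy (Measure.dirac x) 0 := by
  refine tendsto_const_nhds.congr fun n => ?_
  rw [Finset.sum_eq_zero, mul_zero]
  intro w _
  rw [measureReal_def, Measure.dirac_apply' _ (measurableSet_cylinder_ofFn w)]
  by_cases h : x ∈ cylinder (List.ofFn w) <;> simp [Set.indicator, h]

end Pressure

end SymbolSpace

theorem mainTheorem1 {I : Type*} [Fintype I] [Nontrivial I] [TopologicalSpace I]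
    [DiscreteTopology I] [MeasurableSpace I] [BorelSpace I]
    (ψ : ℝ≥0 → List I → (ℕ → I) → ℝ) (hψ : SymbolSpace.IsCylinderFunction ψ) (t : ℝ≥0) :
    ∃ p : EReal, p < ⊤ ∧ SymbolSpace.HasPressure ψ t p ∧
      ((∃ c : ℝ, 0 < c ∧ ∀ w : List I, w ≠ [] → ∀ h : ℕ → I, c ^ w.length ≤ ψ t w h) → ⊥ < p) ∧
      ∃ μ : Measure (ℕ → I), IsProbabilityMeasure μ ∧ Ergodic SymbolSpace.shift μ ∧
        ∃ (s : ℝ) (e : EReal), SymbolSpace.HasEntropy μ s ∧ SymbolSpace.HasEnergy ψ t μ e ∧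
          p = (s : EReal) + e := by
  open SymbolSpace in
  obtain ⟨K, hK, hbv⟩ := hψ.bounded_variation t
  -- A constant sequence is fixed by the shift, so it also serves as the point mass when the
  -- pressure is `⊥`.
  let x : ℕ → I := fun _ => Classical.arbitrary I
  set f := potential (ψ t) K x with hf
  have hsub : ∀ u v, f (u ++ v) ≤ f u + f v := hψ.potential_append_le hK hbv x
  rcases exists_tendsto_div_of_subadditive (u := logPartition f) (logPartition_add_le hsub) with
    hbot | ⟨P, hlim, hP⟩
  · have hp := hasPressure_of_tendsto hψ hK hbv x hbot
    refine ⟨⊥, bot_lt_top, hp, fun ⟨c, hc, h⟩ => hp.bot_lt hc h, Measure.dirac x, inferInstance,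
      ergodic_dirac_of_fixed rfl, 0, ⊥, hasEntropy_dirac x, ?_, by simp⟩
    refine hasEnergy_of_tendsto hψ hK hbv x
      (tendsto_of_tendsto_of_tendsto_of_le_of_le tendsto_const_nhds hbot (fun _ => bot_le)
        fun n => EReal.coe_le_coe (div_le_div_of_nonneg_right ?_ n.cast_nonneg))
    -- Since block entropy is nonnegative, the mean potential alone lies below `logPartition f n`,
    -- which forces the energy to `⊥`.
    have h1 := blockFree_le_logPartition f n (Measure.dirac x)
    rw [blockFree_eq_add] at h1
    linarith [sum_negMulLog_cylinder_nonneg (Measure.dirac x) n]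
  · have hp := hasPressure_of_tendsto hψ hK hbv x ((continuous_coe_real_ereal.tendsto P).comp hlim)
    obtain ⟨μ, hμ, herg, hge⟩ := exists_ergodic_le_blockFree hsub hP hlim
    obtain ⟨s, hs⟩ := exists_hasEntropy herg.map_eq
    refine ⟨P, EReal.coe_lt_top P, hp, fun ⟨c, hc, h⟩ => hp.bot_lt hc h, μ, hμ, herg, s,
      ((P - s : ℝ) : EReal), hs, hasEnergy_of_tendsto hψ hK hbv x ?_, ?_⟩
    · have hF : Tendsto (fun n : ℕ => blockFree f n μ / n) atTop (𝓝 P) := by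
        refine tendsto_of_tendsto_of_tendsto_of_le_of_le' tendsto_const_nhds hlim ?_ ?_
        · filter_upwards [eventually_ne_atTop 0] with n hn
          have hn' : (0 : ℝ) < n := by positivity
          rw [le_div_iff₀ hn']
          linarith [hge n hn]
        · exact Eventually.of_forall fun n =>
            div_le_div_of_nonneg_right (blockFree_le_logPartition f n μ) n.cast_nonneg
      refine (continuous_coe_real_ereal.tendsto _).comp ((hF.sub hs).congr fun n => ?_)
      rw [blockFree_eq_add]
      ring
    · rw [← EReal.coe_add]
      congr 1
      ring
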